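/- Let $n \ge 2$ and let $G=([n],\vec E)$ be a digraph without self-loops and without 2-cycles, where $[n]=\{1,\dots,n\}$. For $\ell\in[n]$ let $R_\ell=(r^{(\ell)}_{i,j})_{i\in[n+1],\,j\in\{1,2\}}$ be the pattern generated by $G$ at $\ell$, that is, the $(n+1)\times 2$ matrix with $r^{(\ell)}_{1,1}=r^{(\ell)}_{\ell+1,2}=\ell$, with $r^{(\ell)}_{j,2}=0$ for $j\in[n+1]\setminus\{\ell+1\}$ and, for $j\in[n]$, with $r^{(\ell)}_{j+1,1}=j$ if $(\ell,j)\in\vec E$ and $r^{(\ell)}_{j+1,1}=n+1$ otherwise. Let $N\ge n+1$, let $(U_{m,i}: m\in\mathbb N_0,\ i\in[n+1])$ be i.i.d. random variables uniformly distributed on $[N]$, and let $X_m$ be the $(n+1)\times 2$ matrix with columns $(U_{m,i})_i$ and $(U_{m+1,i})_i$, so that $(X_m)_{m\in\mathbb N_0}$ is the chain $\mathbf X^{(N,n+1)}$. Let $T_\ell=T_{R_\ell}$ be the first $m\in\mathbb N_0$ such that $X_m$ agrees with $R_\ell$ in the whole first column and in row $\ell+1$ of the second column ($T_\ell=\infty$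 if there is no such $m$). Then the hitting times $T_1,\dots,T_n$ are identically distributed, $\mathbb P(T_i=T_j)=0$ for all $i\ne j$, and the family is 2-determined, which means the following. For sets $A,B\subset[n]$ write $A\to B$ if $\mathbb P(T_j<T_i)>\tfrac12$ for all $i\in A$ and $j\in B$ (that is, all pairs $(i,j)\in A\times B$ are arrows of the ranking graph of $T_1,\dots,T_n$). Then for all nonempty disjoint $A,B\subset[n]$ with $A\to B$, the family $\{T_i:i\in B\}$ is small with respect to $\{T_i:i\in A\}$, i.e. $$\frac1{|B|}\sum_{i\in B}p_i \;>\; \frac1{|A|}\sum_{i\in A}p_i,\qquad p_i:=\mathbb P\bigl(T_i\le T_j\ \text{for all } j\in A\cup B\bigr).$$ -/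

import Mathlib

open MeasureTheory ProbabilityTheory

namespace PatternRank

/-! ### Ranking graphs, first-hit probabilities, smallness -/

section Ranking

variable {Ω : Type*} [MeasurableSpace Ω] {α : Type*} [LinearOrder α] {ι : Type*}

/-- The graph has neither self-loops nor 2-cycles (the case `i = j` excludes the loops). -/
def IsOriented (G : Digraph ι) : Prop :=
  ∀ i j, G.Adj i j → ¬ G.Adj j i

/-- `A → B`: every vertex of `A` has an arrow to every vertex of `B`. -/
def PointsTo (G : Digraph ι) (A B : Finset ι) : Prop :=
  ∀ i ∈ A, ∀ j ∈ B, G.Adj i j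

/-- No two members of the family `(S i : i ∈ C)` are equal with positive probability. -/
def NoTie (μ : Measure Ω) (S : ι → Ω → α) (C : Set ι) : Prop :=
  ∀ i ∈ C, ∀ j ∈ C, i ≠ j → μ {ω | S i ω = S j ω} = 0

/-- The ranking graph: `(i, j)` is an arrow iff `P (S j < S i) > 1 / 2`. -/
def rankingGraph (μ : Measure Ω) (S : ι → Ω → α) : Digraph ι where
  Adj i j := 1 / 2 < μ.real {ω | S j ω < S i ω}

/-- `p_i` of the family `(S j : j ∈ C)`: the probability that `S i` is the smallest of them. -/
noncomputable def firstProb (μ : Measure Ω) (S : ι → Ω → α) (C : Finset ι) (i : ι) : ℝ :=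
  μ.real {ω | ∀ j ∈ C, S i ω ≤ S j ω}

/-- For nonempty `A` and `B`: the family `(S i : i ∈ A)` is small with respect to
`(S i : i ∈ B)`. -/
def IsSmall [DecidableEq ι] (μ : Measure Ω) (S : ι → Ω → α) (A B : Finset ι) : Prop :=
  NoTie μ S (A ∪ B : Finset ι) ∧
    (1 / (B.card : ℝ)) * ∑ i ∈ B, firstProb μ S (A ∪ B) i <
      (1 / (A.card : ℝ)) * ∑ i ∈ A, firstProb μ S (A ∪ B) i

/-- The family is 2-determined: whenever `A → B` in its own ranking graph, `(S i : i ∈ B)` is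
small with respect to `(S i : i ∈ A)`. -/
def IsTwoDetermined [DecidableEq ι] (μ : Measure Ω) (S : ι → Ω → α) : Prop :=
  ∀ A B : Finset ι, A.Nonempty → B.Nonempty → Disjoint A B →
    PointsTo (rankingGraph μ S) A B → IsSmall μ S B A

end Ranking

/-! ### The chain -/

section Chain

variable {Ω : Type*}

/-- The entries `U m i` (`m ∈ ℕ`, `i` one of `k` rows) are i.i.d. uniform on `{1, …, N}`. -/
structure IsUniformArray [MeasurableSpace Ω] (μ : Measure Ω) (N : ℕ) {k : ℕ}
    (U : ℕ → Fin k → Ω → ℕ) : Prop where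
  measurable : ∀ m i, Measurable (U m i)
  indep : iIndepFun (fun p : ℕ × Fin k => U p.1 p.2) μ
  uniform : ∀ m i, μ.map (U m i) = uniformOn (Set.Icc 1 N)

/-- The chain `X_m = [U_m, U_{m+1}]`, with values in the `k × 2` matrices. -/
def chain {k : ℕ} (U : ℕ → Fin k → Ω → ℕ) (m : ℕ) (ω : Ω) : Matrix (Fin k) (Fin 2) ℕ :=
  Matrix.of fun i j => U (m + (j : ℕ)) i ω

end Chain

/-! ### Patterns -/

/-- A pattern: a `k × 2` matrix over `{0, …, M}` whose first column has no zero entry and whose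
second column has exactly one nonzero entry. -/
structure Pattern (M k : ℕ) where
  entry : Matrix (Fin k) (Fin 2) ℕ
  fst_mem : ∀ i, entry i 0 ∈ Set.Icc 1 M
  snd_le : ∀ i, entry i 1 ≤ M
  existsUnique_snd : ∃! i, entry i 1 ≠ 0

namespace Pattern

variable {M k : ℕ}

/-- The index of hump: the row of the nonzero entry of the second column. -/
noncomputable def hump (Q : Pattern M k) : Fin k :=
  Q.existsUnique_snd.choose

theorem entry_hump_ne_zero (Q : Pattern M k) : Q.entry Q.hump 1 ≠ 0 :=
  Q.existsUnique_snd.choose_spec.1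

theorem eq_hump (Q : Pattern M k) {i : Fin k} (hi : Q.entry i 1 ≠ 0) : i = Q.hump :=
  Q.existsUnique_snd.choose_spec.2 i hi

end Pattern

/-- The projection `Π_h`: replace by `0` every entry of the second column outside row `h`. -/
def proj {k : ℕ} (h : Fin k) (S : Matrix (Fin k) (Fin 2) ℕ) : Matrix (Fin k) (Fin 2) ℕ :=
  Matrix.of fun i j => if j = 0 ∨ i = h then S i j else 0

/-- The first time `m` at which `Π_{h(R)} (X_m) = R` (`⊤` if there is none). -/
noncomputable def patternTime {Ω : Type*} {M k : ℕ} (U : ℕ → Fin k → Ω → ℕ) (R : Pattern M k) :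
    Ω → ℕ∞ :=
  hittingAfter (chain U) {S | proj R.hump S = R.entry} 0

/-! ### The patterns generated by a graph

The vertex `l : Fin n` stands for the number `l + 1` of `{1, …, n}`. Row `0` is the first row, so
that row `Fin.succ j` belongs to the vertex `j`. -/

open Classical in
/-- The matrix of the pattern generated at the vertex `l`. Its second column has the number of `l`
in the row of `l` and `0` elsewhere. Its first column has the number of `l` in the first row, and
in the row of `j` the number of `j` if `(l, j)` is an arrow and `n + 1` otherwise. -/
noncomputable def generatedEntry {n : ℕ} (G : Digraph (Fin n)) (l : Fin n) :
    Matrix (Fin (n + 1)) (Fin 2) ℕ :=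
  Matrix.of fun i j =>
    if j = 0 then
      Fin.cases ((l : ℕ) + 1) (fun v => if G.Adj l v then (v : ℕ) + 1 else n + 1) i
    else
      if i = l.succ then (l : ℕ) + 1 else 0

/-- The pattern `R_l` generated by `G` at the vertex `l`. -/
noncomputable def generatedPattern {n : ℕ} (G : Digraph (Fin n)) (l : Fin n) :
    Pattern (n + 1) (n + 1) where
  entry := generatedEntry G l
  fst_mem i := by
    have hl := l.isLt
    refine Fin.cases ?_ (fun v => ?_) i
    · simp [generatedEntry]
    · have hv := v.isLt
      by_cases h : G.Adj l v
      · simp [generatedEntry, h]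
      · simp [generatedEntry, h]
  snd_le i := by
    have hl := l.isLt
    by_cases h : i = l.succ
    · simp [generatedEntry, h]
    · simp [generatedEntry, h]
  existsUnique_snd := ⟨l.succ, by simp [generatedEntry], fun i hi => by
    by_contra h
    exact hi (by simp [generatedEntry, h])⟩

end PatternRank

/-! Fix a set `C` of competing vertices and let `p_i` be the probability that the pattern at `i`
comes first. If nothing has occurred before time `k`, an occurrence at `k + 1` is independent of
that past and has probability `N⁻¹ ^ (n + 2)`, whatever the vertex `j`. Split this event by what
happens at time `k`. Either nothing of `C` occurs, and `j` is first at `k + 1`; or some `i` is first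
at `k`, and then the two patterns overlap in a single entry, which agrees when `j → i` and clashes
otherwise. Agreement leaves `n + 1` free entries. This is `renewal`.

Summing over `k` gives the balance equations `p_j + q * ∑_{i ∈ C, j → i} p_i = K` with `q = N⁻¹ ^ (n
+ 1)` and `K` independent of `j ∈ C` (`exists_firstProb_balance`): arrows out of `j` lower its
chance to be first. For a pair `C = {i, j}` they show that every arrow of the ranking graph between
distinct vertices is an arrow of `G`. For `C = A ∪ B` with `A → B`, adding them over `A` and over
`B` and eliminating `K` compares the two averages (`average_lt_average_of_balance`). -/

namespace PatternRank

/-! ### Independence and cylinder probabilities for the array -/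

section Cylinder

variable {Ω : Type*} {N k : ℕ} {U : ℕ → Fin k → Ω → ℕ}

/-- The σ-algebra generated by the entries of the array at the positions in `S`. -/
@[reducible]
def coordSigma (U : ℕ → Fin k → Ω → ℕ) (S : Set (ℕ × Fin k)) : MeasurableSpace Ω :=
  ⨆ p ∈ S, MeasurableSpace.comap (U p.1 p.2) Nat.instMeasurableSpace

/-- The event that the entries at the positions in `S` take the values prescribed by `c`. -/
def cylinder (U : ℕ → Fin k → Ω → ℕ) (S : Finset (ℕ × Fin k)) (c : ℕ × Fin k → ℕ) : Set Ω :=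
  ⋂ p ∈ S, U p.1 p.2 ⁻¹' {c p}

theorem mem_cylinder {S : Finset (ℕ × Fin k)} {c : ℕ × Fin k → ℕ} {ω : Ω} :
    ω ∈ cylinder U S c ↔ ∀ p ∈ S, U p.1 p.2 ω = c p := by
  simp [cylinder]

theorem measurableSet_coordSigma_cylinder {S : Finset (ℕ × Fin k)} {S' : Set (ℕ × Fin k)}
    (h : (S : Set (ℕ × Fin k)) ⊆ S') (c : ℕ × Fin k → ℕ) :
    MeasurableSet[coordSigma U S'] (cylinder U S c) := by
  refine @Finset.measurableSet_biInter _ _ (coordSigma U S') _ S fun p hp => ?_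
  exact le_iSup₂ (f := fun (q : ℕ × Fin k) (_ : q ∈ S') => MeasurableSpace.comap (U q.1 q.2) Nat.instMeasurableSpace)
    p (h hp) _ ⟨{c p}, trivial, rfl⟩

variable [MeasurableSpace Ω] {μ : Measure Ω}

theorem coordSigma_le (hU : IsUniformArray μ N U) (S : Set (ℕ × Fin k)) :
    coordSigma U S ≤ ‹MeasurableSpace Ω› :=
  iSup₂_le fun p _ => (hU.measurable p.1 p.2).comap_le

theorem measureReal_inter_of_disjoint (hU : IsUniformArray μ N U) {S S' : Set (ℕ × Fin k)}
    (hS : Disjoint S S') {s t : Set Ω} (hs : MeasurableSet[coordSigma U S] s)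
    (ht : MeasurableSet[coordSigma U S'] t) : μ.real (s ∩ t) = μ.real s * μ.real t := by
  have h : Indep (coordSigma U S) (coordSigma U S') μ :=
    indep_iSup_of_disjoint
      (m := fun p : ℕ × Fin k => MeasurableSpace.comap (U p.1 p.2) Nat.instMeasurableSpace)
      (fun p => (hU.measurable p.1 p.2).comap_le) hU.indep.iIndep hS
  rw [measureReal_def, (Indep_iff _ _ _).1 h s t hs ht, ENNReal.toReal_mul]
  rfl

theorem measureReal_cylinder (hU : IsUniformArray μ N U) {S : Finset (ℕ × Fin k)}
    {c : ℕ × Fin k → ℕ} (hc : ∀ p ∈ S, c p ∈ Set.Icc 1 N) :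
    μ.real (cylinder U S c) = ((N : ℝ)⁻¹) ^ S.card := by
  have h1 : ∀ p ∈ S, μ (U p.1 p.2 ⁻¹' {c p}) = (N : ENNReal)⁻¹ := by
    intro p hp
    rw [← Measure.map_apply (hU.measurable _ _) (measurableSet_singleton _), hU.uniform]
    have h2 : (Set.Icc 1 N : Set ℕ) = ((Finset.Icc 1 N : Finset ℕ) : Set ℕ) := by simp
    have h3 : ({c p} : Set ℕ) = (({c p} : Finset ℕ) : Set ℕ) := by simp
    rw [h2, h3, uniformOn_apply_finset,
      Finset.inter_singleton_of_mem (Finset.mem_Icc.2 (hc p hp))]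
    simp
  have h4 := iIndepFun.meas_biInter (S := S) (s := fun p => U p.1 p.2 ⁻¹' {c p}) hU.indep
    fun p _ => ⟨{c p}, trivial, rfl⟩
  rw [measureReal_def, cylinder, h4, Finset.prod_congr rfl h1, Finset.prod_const]
  simp

end Cylinder

/-! ### First-hit decomposition for families of events -/

section FirstHit

variable {Ω ι : Type*}

/-- None of the events `E c t` with `c ∈ C` and `t < k` occurs. -/
def noHit (E : ι → ℕ → Set Ω) (C : Finset ι) (k : ℕ) : Set Ω :=
  {ω | ∀ t < k, ∀ c ∈ C, ω ∉ E c t}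

/-- At time `k` the event `E i k` occurs, and before time `k` no event of the family `C` does. -/
def firstHit (E : ι → ℕ → Set Ω) (C : Finset ι) (i : ι) (k : ℕ) : Set Ω :=
  E i k ∩ noHit E C k

variable {E : ι → ℕ → Set Ω} {C : Finset ι}

@[simp]
theorem noHit_zero : noHit E C 0 = Set.univ := by
  simp [noHit]

theorem noHit_eq_iInter (k : ℕ) :
    noHit E C k = ⋂ t ∈ Finset.range k, ⋂ c ∈ C, (E c t)ᶜ := by
  ext ω
  simp [noHit]

theorem measurableSet_noHit {m : MeasurableSpace Ω} {k : ℕ}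
    (h : ∀ t < k, ∀ c ∈ C, MeasurableSet (E c t)) : MeasurableSet (noHit E C k) := by
  rw [noHit_eq_iInter]
  exact Finset.measurableSet_biInter _ fun t ht => Finset.measurableSet_biInter _
    fun c hc => (h t (Finset.mem_range.1 ht) c hc).compl

theorem noHit_eq_union (k : ℕ) :
    noHit E C k = noHit E C (k + 1) ∪ ⋃ i ∈ C, firstHit E C i k := by
  ext ω
  simp only [noHit, firstHit, Set.mem_union, Set.mem_ofPred_eq, Set.mem_iUnion, Set.mem_inter_iff,
    Order.lt_add_one_iff, exists_prop]
  constructor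
  · intro h
    by_cases h' : ∃ i ∈ C, ω ∈ E i k
    · obtain ⟨i, hi, hω⟩ := h'
      exact Or.inr ⟨i, hi, hω, h⟩
    · push Not at h'
      refine Or.inl fun t ht c hc => ?_
      rcases ht.lt_or_eq with ht | rfl
      · exact h t ht c hc
      · exact h' c hc
  · rintro (h | ⟨i, -, -, h⟩)
    · exact fun t ht => h t ht.le
    · exact h

theorem disjoint_noHit_firstHit {i : ι} (hi : i ∈ C) (k : ℕ) :
    Disjoint (noHit E C (k + 1)) (firstHit E C i k) :=
  Set.disjoint_left.2 fun _ h h' => h k k.lt_succ_self i hi h'.1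

theorem disjoint_firstHit_of_lt {i j : ι} (hi : i ∈ C) {k l : ℕ} (h : k < l) :
    Disjoint (firstHit E C i k) (firstHit E C j l) :=
  Set.disjoint_left.2 fun _ h1 h2 => h2.2 k h i hi h1.1

end FirstHit

/-! ### Occurrences of generated patterns and their one-step overlaps -/

section Occurrence

variable {Ω : Type*} {n N : ℕ} {G : Digraph (Fin n)} {U : ℕ → Fin (n + 1) → Ω → ℕ}

/-- The event that the generated pattern at `l` occurs at time `m`. -/
def occurrence (U : ℕ → Fin (n + 1) → Ω → ℕ) (G : Digraph (Fin n)) (l : Fin n) (m : ℕ) :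
    Set Ω :=
  {ω | (∀ r, U m r ω = generatedEntry G l r 0) ∧ U (m + 1) l.succ ω = (l : ℕ) + 1}

theorem hump_generatedPattern (G : Digraph (Fin n)) (l : Fin n) :
    (generatedPattern G l).hump = l.succ :=
  ((generatedPattern G l).eq_hump (by simp [generatedPattern, generatedEntry])).symm

theorem proj_chain_eq_iff {l : Fin n} {m : ℕ} {ω : Ω} :
    proj (generatedPattern G l).hump (chain U m ω) = (generatedPattern G l).entry ↔
      ω ∈ occurrence U G l m := by
  rw [hump_generatedPattern]
  constructor
  · intro h
    refine ⟨fun r => ?_, ?_⟩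
    · simpa [proj, chain, generatedPattern] using congrFun (congrFun h r) 0
    · simpa [proj, chain, generatedPattern, generatedEntry] using congrFun (congrFun h l.succ) 1
  · rintro ⟨h1, h2⟩
    ext r j
    fin_cases j
    · simpa [proj, chain, generatedPattern] using h1 r
    · by_cases hr : r = l.succ
      · subst hr
        simpa [proj, chain, generatedPattern, generatedEntry] using h2
      · simp [proj, chain, generatedPattern, generatedEntry, hr]

theorem natCast_le_patternTime {l : Fin n} {k : ℕ} {ω : Ω} :
    (k : ℕ∞) ≤ patternTime U (generatedPattern G l) ω ↔ ∀ t < k, ω ∉ occurrence U G l t := by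
  rw [← not_lt]
  have h := hittingAfter_lt_iff (u := chain U) (n := 0) (i := k) (ω := ω)
    (s := {S | proj (generatedPattern G l).hump S = (generatedPattern G l).entry})
  refine (not_congr h).trans ?_
  simp [proj_chain_eq_iff]

/-- The first row of the first column carries the number of the vertex. -/
theorem disjoint_occurrence {i j : Fin n} (hij : i ≠ j) (m : ℕ) :
    Disjoint (occurrence U G i m) (occurrence U G j m) := by
  refine Set.disjoint_left.2 fun ω hi hj => hij (Fin.ext ?_)
  simpa [generatedEntry] using (hi.1 0).symm.trans (hj.1 0)

/-- The positions of the array that decide whether the pattern at `l` occurs at time `m`. -/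
def occurrencePositions (l : Fin n) (m : ℕ) : Finset (ℕ × Fin (n + 1)) :=
  insert (m + 1, l.succ) (Finset.univ.map (Function.Embedding.sectR m (Fin (n + 1))))

theorem mem_occurrencePositions {l : Fin n} {m : ℕ} {p : ℕ × Fin (n + 1)} :
    p ∈ occurrencePositions l m ↔ p.1 = m ∨ p = (m + 1, l.succ) := by
  obtain ⟨a, b⟩ := p
  simp [occurrencePositions, or_comm, eq_comm]

/-- The values required at these positions. -/
noncomputable def occurrenceValues (G : Digraph (Fin n)) (l : Fin n) (m : ℕ)
    (p : ℕ × Fin (n + 1)) : ℕ :=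
  if p.1 = m then generatedEntry G l p.2 0 else (l : ℕ) + 1

theorem occurrence_eq_cylinder (l : Fin n) (m : ℕ) :
    occurrence U G l m =
      cylinder U (occurrencePositions l m) (occurrenceValues G l m) := by
  refine Set.ext fun ω => Iff.trans ?_ mem_cylinder.symm
  simp only [occurrence, mem_occurrencePositions, Set.mem_ofPred_eq]
  constructor
  · rintro ⟨h1, h2⟩ ⟨a, b⟩ (h | h)
    · obtain rfl : a = m := h
      simpa [occurrenceValues] using h1 b
    · obtain ⟨rfl, rfl⟩ := Prod.mk.inj h
      simpa [occurrenceValues] using h2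
  · intro h
    exact ⟨fun r => by simpa [occurrenceValues] using h (m, r) (Or.inl rfl),
      by simpa [occurrenceValues] using h (m + 1, l.succ) (Or.inr rfl)⟩

theorem occurrenceValues_mem (hN : n + 1 ≤ N) (l : Fin n) (m : ℕ) (p : ℕ × Fin (n + 1)) :
    occurrenceValues G l m p ∈ Set.Icc 1 N := by
  unfold occurrenceValues
  split_ifs
  · exact Set.Icc_subset_Icc_right hN ((generatedPattern G l).fst_mem p.2)
  · have := l.isLt
    exact ⟨by omega, by omega⟩

/-- Both patterns constrain the entry `(k + 1, i.succ)`: the first demands the number of `i`, at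
most `n`, the second demands `n + 1`. -/
theorem occurrence_inter_occurrence_succ_eq_empty {i j : Fin n} (h : ¬ G.Adj j i) (k : ℕ) :
    occurrence U G i k ∩ occurrence U G j (k + 1) = ∅ := by
  refine Set.eq_empty_iff_forall_notMem.2 fun ω hω => ?_
  have h1 := hω.1.2.symm.trans (hω.2.1 i.succ)
  have h2 := i.isLt
  simp only [generatedEntry, Matrix.of_apply, if_true, Fin.cases_succ, if_neg h] at h1
  omega

theorem measurableSet_coordSigma_occurrence {l : Fin n} {m : ℕ} {S : Set (ℕ × Fin (n + 1))}
    (hS : ∀ p : ℕ × Fin (n + 1), p.1 = m ∨ p = (m + 1, l.succ) → p ∈ S) :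
    MeasurableSet[coordSigma U S] (occurrence U G l m) := by
  rw [occurrence_eq_cylinder]
  exact measurableSet_coordSigma_cylinder
    (fun p hp => hS p (mem_occurrencePositions.1 hp)) _

variable [MeasurableSpace Ω] {μ : Measure Ω}

theorem measurableSet_occurrence (hU : IsUniformArray μ N U) (l : Fin n) (m : ℕ) :
    MeasurableSet (occurrence U G l m) :=
  coordSigma_le hU Set.univ _ (measurableSet_coordSigma_occurrence fun _ _ => trivial)

theorem measurableSet_firstHit_occurrence (hU : IsUniformArray μ N U) (C : Finset (Fin n))
    (i : Fin n) (k : ℕ) : MeasurableSet (firstHit (occurrence U G) C i k) :=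
  (measurableSet_occurrence hU i k).inter
    (measurableSet_noHit fun t _ c _ => measurableSet_occurrence hU c t)

theorem measureReal_occurrence (hU : IsUniformArray μ N U) (hN : n + 1 ≤ N) (l : Fin n) (m : ℕ) :
    μ.real (occurrence U G l m) = ((N : ℝ)⁻¹) ^ (n + 2) := by
  rw [occurrence_eq_cylinder, measureReal_cylinder hU fun p _ => occurrenceValues_mem hN l m p,
    occurrencePositions, Finset.card_insert_of_notMem (by simp)]
  simp

/-- Occurrences at times `t < k` read the array only up to time `k`, while the one at `k + 1` reads
times `k + 1` and `k + 2`. -/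
theorem measureReal_noHit_inter_occurrence_succ [IsProbabilityMeasure μ]
    (hU : IsUniformArray μ N U) (hN : n + 1 ≤ N) (C : Finset (Fin n)) (j : Fin n) (k : ℕ) :
    μ.real (noHit (occurrence U G) C k ∩ occurrence U G j (k + 1)) =
      μ.real (noHit (occurrence U G) C k) * ((N : ℝ)⁻¹) ^ (n + 2) := by
  rw [measureReal_inter_of_disjoint hU (S := {p | p.1 ≤ k}) (S' := {p | k < p.1}),
    measureReal_occurrence hU hN]
  · exact Set.disjoint_left.2 fun p (h1 : p.1 ≤ k) (h2 : k < p.1) => h1.not_gt h2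
  · refine measurableSet_noHit fun t ht c _ => measurableSet_coordSigma_occurrence ?_
    rintro p (h | rfl)
    · exact h.trans_le ht.le
    · exact ht
  · refine measurableSet_coordSigma_occurrence ?_
    rintro p (h | rfl)
    · exact (Nat.lt_succ_self k).trans_le h.ge
    · exact Nat.lt_succ_of_lt (Nat.lt_succ_self k)

open Classical in
theorem measureReal_firstHit_inter_occurrence_succ
    (hU : IsUniformArray μ N U) (hN : n + 1 ≤ N) (C : Finset (Fin n)) (i j : Fin n) (k : ℕ) :
    μ.real (firstHit (occurrence U G) C i k ∩ occurrence U G j (k + 1)) =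
      ((N : ℝ)⁻¹) ^ (n + 1) *
        if G.Adj j i then μ.real (firstHit (occurrence U G) C i k) else 0 := by
  split_ifs with h
  -- The occurrence of `i` at time `k` already fixes the shared entry at the value that `j` needs;
  -- the other `n + 1` positions are independent of the first hit.
  · set S := (occurrencePositions j (k + 1)).erase (k + 1, i.succ) with hS
    have hmem : (k + 1, i.succ) ∈ occurrencePositions j (k + 1) :=
      mem_occurrencePositions.2 (Or.inl rfl)
    have hval : occurrenceValues G j (k + 1) (k + 1, i.succ) = (i : ℕ) + 1 := by
      simp [occurrenceValues, generatedEntry, h]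
    have h1 : firstHit (occurrence U G) C i k ∩ occurrence U G j (k + 1) =
        firstHit (occurrence U G) C i k ∩ cylinder U S (occurrenceValues G j (k + 1)) := by
      ext ω
      refine and_congr_right fun hω => ?_
      rw [occurrence_eq_cylinder, mem_cylinder, mem_cylinder]
      refine ⟨fun h' p hp => h' p (Finset.mem_of_mem_erase hp), fun h' p hp => ?_⟩
      by_cases hpe : p = (k + 1, i.succ)
      · rw [hpe, hval]
        exact hω.1.2
      · exact h' p (Finset.mem_erase.2 ⟨hpe, hp⟩)
    have hcard : S.card = n + 1 := by
      rw [hS, Finset.card_erase_of_mem hmem, occurrencePositions,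
        Finset.card_insert_of_notMem (by simp)]
      simp
    rw [h1, measureReal_inter_of_disjoint hU (S := {p | p.1 ≤ k ∨ p = (k + 1, i.succ)})
      (S' := {p | k < p.1 ∧ p ≠ (k + 1, i.succ)}),
      measureReal_cylinder hU fun p _ => occurrenceValues_mem hN j _ p, hcard, mul_comm]
    · exact Set.disjoint_left.2 fun p h1 h2 => h1.elim (not_le.2 h2.1) h2.2
    · refine MeasurableSet.inter ?_ (measurableSet_noHit fun t ht c _ => ?_)
      · refine measurableSet_coordSigma_occurrence ?_
        rintro p (h | rfl)
        · exact Or.inl h.le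
        · exact Or.inr rfl
      · refine measurableSet_coordSigma_occurrence ?_
        rintro p (h | rfl)
        · exact Or.inl (h.trans_le ht.le)
        · exact Or.inl ht
    · refine measurableSet_coordSigma_cylinder (fun p hp => ?_) _
      obtain ⟨h2, h3⟩ := Finset.mem_erase.1 hp
      refine ⟨?_, h2⟩
      rcases mem_occurrencePositions.1 h3 with h | rfl
      · exact (Nat.lt_succ_self k).trans_le h.ge
      · exact Nat.lt_succ_of_lt (Nat.lt_succ_self k)
  · have h1 : firstHit (occurrence U G) C i k ∩ occurrence U G j (k + 1) ⊆ ∅ :=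
      (Set.inter_subset_inter_left _ Set.inter_subset_left).trans
        (occurrence_inter_occurrence_succ_eq_empty h k).subset
    rw [Set.subset_empty_iff.1 h1]
    simp

end Occurrence
-- Renewal and balance equations
section Renewal

open Filter Topology

variable {Ω : Type*} [MeasurableSpace Ω] {μ : Measure Ω} {n N : ℕ}
  {G : Digraph (Fin n)} {U : ℕ → Fin (n + 1) → Ω → ℕ}

theorem measureReal_firstHit_zero (hU : IsUniformArray μ N U) (hN : n + 1 ≤ N)
    (C : Finset (Fin n)) (j : Fin n) :
    μ.real (firstHit (occurrence U G) C j 0) = ((N : ℝ)⁻¹) ^ (n + 2) := by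
  rw [firstHit, noHit_zero, Set.inter_univ, measureReal_occurrence hU hN]

variable [IsProbabilityMeasure μ]

theorem measureReal_noHit_inter (hU : IsUniformArray μ N U) (C : Finset (Fin n)) (k : ℕ)
    {s : Set Ω} (hs : MeasurableSet s) :
    μ.real (noHit (occurrence U G) C k ∩ s) =
      μ.real (noHit (occurrence U G) C (k + 1) ∩ s) +
        ∑ i ∈ C, μ.real (firstHit (occurrence U G) C i k ∩ s) := by
  have hm : ∀ i, MeasurableSet (firstHit (occurrence U G) C i k ∩ s) := fun i =>
    (measurableSet_firstHit_occurrence hU C i k).inter hs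
  rw [noHit_eq_union, Set.union_inter_distrib_right, Set.iUnion₂_inter, measureReal_union ?_ ?_ (measure_ne_top _ _)
    (measure_ne_top _ _), measureReal_biUnion_finset]
  · intro i _ j _ hij
    exact (disjoint_occurrence hij k).mono (Set.inter_subset_left.trans Set.inter_subset_left)
      (Set.inter_subset_left.trans Set.inter_subset_left)
  · exact fun i _ => hm i
  · refine Set.disjoint_iUnion₂_right.2 fun i hi => ?_
    exact (disjoint_noHit_firstHit hi k).mono Set.inter_subset_left Set.inter_subset_left
  · exact Finset.measurableSet_biUnion _ fun i _ => hm i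

theorem measureReal_noHit (hU : IsUniformArray μ N U) (C : Finset (Fin n)) (k : ℕ) :
    μ.real (noHit (occurrence U G) C k) =
      μ.real (noHit (occurrence U G) C (k + 1)) +
        ∑ i ∈ C, μ.real (firstHit (occurrence U G) C i k) := by
  simpa using measureReal_noHit_inter (G := G) hU C k MeasurableSet.univ

open Classical in
-- Both sides compute the probability of no hit before `k` together with an occurrence of `j` at `k
-- + 1`: by independence on the left, by cases on time `k` on the right.
theorem renewal (hU : IsUniformArray μ N U) (hN : n + 1 ≤ N) (C : Finset (Fin n)) (j : Fin n)
    (k : ℕ) :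
    μ.real (noHit (occurrence U G) C k) * ((N : ℝ)⁻¹) ^ (n + 2) =
      μ.real (firstHit (occurrence U G) C j (k + 1)) + ((N : ℝ)⁻¹) ^ (n + 1) *
        ∑ i ∈ C, if G.Adj j i then μ.real (firstHit (occurrence U G) C i k) else 0 := by
  rw [← measureReal_noHit_inter_occurrence_succ hU hN C j k,
    measureReal_noHit_inter hU C k (measurableSet_occurrence hU j (k + 1)), Finset.mul_sum,
    Set.inter_comm, firstHit]
  exact congrArg _ (Finset.sum_congr rfl fun i _ =>
    measureReal_firstHit_inter_occurrence_succ hU hN C i j k)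

theorem hasSum_measureReal_firstHit (hU : IsUniformArray μ N U) {C : Finset (Fin n)} {i : Fin n}
    (hi : i ∈ C) :
    HasSum (fun k => μ.real (firstHit (occurrence U G) C i k))
      (μ.real (⋃ k, firstHit (occurrence U G) C i k)) := by
  have hd : Pairwise (Function.onFun Disjoint (firstHit (occurrence U G) C i)) := by
    intro k l hkl
    rcases hkl.lt_or_gt with h | h
    · exact disjoint_firstHit_of_lt hi h
    · exact (disjoint_firstHit_of_lt hi h).symm
  have h := measure_iUnion (μ := μ) hd (measurableSet_firstHit_occurrence hU C i)
  have h' := ENNReal.hasSum_toReal (h ▸ measure_ne_top μ _)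
  rw [← ENNReal.tsum_toReal_eq fun _ => measure_ne_top μ _, ← h] at h'
  exact h'

/-- First-hit events at different times are disjoint, so their probabilities are summable and tend
to `0`; `renewal` expresses the no-hit probability through finitely many of them. -/
theorem tendsto_measureReal_noHit (hU : IsUniformArray μ N U) (hN : n + 1 ≤ N)
    {C : Finset (Fin n)} (hC : C.Nonempty) :
    Tendsto (fun k => μ.real (noHit (occurrence U G) C k)) atTop (𝓝 0) := by
  classical
  obtain ⟨j, hj⟩ := hC
  have hp : (0 : ℝ) < ((N : ℝ)⁻¹) ^ (n + 2) := by
    have : (0 : ℝ) < N := by exact_mod_cast (by omega : 0 < N)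
    positivity
  have h0 : ∀ i ∈ C,
      Tendsto (fun k => μ.real (firstHit (occurrence U G) C i k)) atTop (𝓝 0) := fun i hi =>
    (hasSum_measureReal_firstHit hU hi).summable.tendsto_atTop_zero
  have h1 : Tendsto (fun k => μ.real (firstHit (occurrence U G) C j (k + 1)) +
      ((N : ℝ)⁻¹) ^ (n + 1) *
        ∑ i ∈ C, if G.Adj j i then μ.real (firstHit (occurrence U G) C i k) else 0)
      atTop (𝓝 (0 + ((N : ℝ)⁻¹) ^ (n + 1) * ∑ i ∈ C, 0)) := by
    refine ((h0 j hj).comp (tendsto_add_atTop_nat 1)).add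
      (Tendsto.const_mul _ (tendsto_finsetSum _ fun i hi => ?_))
    by_cases h : G.Adj j i
    · simpa [h] using h0 i hi
    · simp [h]
  simp_rw [← renewal hU hN C j] at h1
  have h2 := h1.div_const (((N : ℝ)⁻¹) ^ (n + 2))
  simp_rw [mul_div_cancel_right₀ _ hp.ne'] at h2
  simpa using h2

theorem measure_iInter_noHit (hU : IsUniformArray μ N U) (hN : n + 1 ≤ N)
    {C : Finset (Fin n)} (hC : C.Nonempty) :
    μ (⋂ k, noHit (occurrence U G) C k) = 0 := by
  rw [← measureReal_eq_zero_iff]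
  refine le_antisymm (ge_of_tendsto' (tendsto_measureReal_noHit (G := G) hU hN hC) fun k => ?_)
    measureReal_nonneg
  exact measureReal_mono (Set.iInter_subset _ k)

theorem sum_measureReal_iUnion_firstHit (hU : IsUniformArray μ N U) (hN : n + 1 ≤ N)
    {C : Finset (Fin n)} (hC : C.Nonempty) :
    ∑ i ∈ C, μ.real (⋃ k, firstHit (occurrence U G) C i k) = 1 := by
  have h1 := (hasSum_sum fun i hi =>
    hasSum_measureReal_firstHit (G := G) (C := C) hU hi).tendsto_sum_nat
  have h2 : ∀ K, ∑ k ∈ Finset.range K, ∑ i ∈ C, μ.real (firstHit (occurrence U G) C i k) =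
      1 - μ.real (noHit (occurrence U G) C K) := by
    intro K
    induction K with
    | zero => simp
    | succ K ih =>
      rw [Finset.sum_range_succ, ih, measureReal_noHit hU C K]
      ring
  simp_rw [h2] at h1
  have h3 := (tendsto_measureReal_noHit (G := G) hU hN hC).const_sub 1
  rw [sub_zero] at h3
  exact tendsto_nhds_unique h1 h3

open Classical in
theorem exists_firstHit_balance (hU : IsUniformArray μ N U) (hN : n + 1 ≤ N)
    (C : Finset (Fin n)) :
    ∃ K : ℝ, ∀ j ∈ C, μ.real (⋃ k, firstHit (occurrence U G) C j k) +
      ((N : ℝ)⁻¹) ^ (n + 1) * ∑ i ∈ C,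
        (if G.Adj j i then μ.real (⋃ k, firstHit (occurrence U G) C i k) else 0) = K := by
  -- The hit probability at time `0`, which `renewal` does not cover, plus the sum of the left sides
  -- of `renewal`; neither depends on `j`.
  refine ⟨((N : ℝ)⁻¹) ^ (n + 2) +
    ∑' k, μ.real (noHit (occurrence U G) C k) * ((N : ℝ)⁻¹) ^ (n + 2), fun j hj => ?_⟩
  have h1 := (hasSum_nat_add_iff' 1).2 (hasSum_measureReal_firstHit (G := G) hU hj)
  have h2 : HasSum (fun k => ∑ i ∈ C,
      if G.Adj j i then μ.real (firstHit (occurrence U G) C i k) else 0)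
      (∑ i ∈ C, if G.Adj j i then μ.real (⋃ k, firstHit (occurrence U G) C i k) else 0) := by
    refine hasSum_sum fun i hi => ?_
    split_ifs
    · exact hasSum_measureReal_firstHit hU hi
    · exact hasSum_zero
  have h3 := h1.add (h2.mul_left (((N : ℝ)⁻¹) ^ (n + 1)))
  simp_rw [← renewal hU hN C j] at h3
  rw [h3.tsum_eq, Finset.sum_range_one, measureReal_firstHit_zero hU hN]
  ring

/-- Without loops the overlap term of `renewal` for a single vertex vanishes, leaving a recursion
that does not see the vertex. -/
theorem measureReal_firstHit_singleton_eq (hU : IsUniformArray μ N U) (hN : n + 1 ≤ N)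
    (hG : ∀ i, ¬ G.Adj i i) (i j : Fin n) (k : ℕ) :
    μ.real (firstHit (occurrence U G) {i} i k) = μ.real (firstHit (occurrence U G) {j} j k) := by
  have hr : ∀ (l : Fin n) (m : ℕ), μ.real (noHit (occurrence U G) {l} m) * ((N : ℝ)⁻¹) ^ (n + 2) =
      μ.real (firstHit (occurrence U G) {l} l (m + 1)) := fun l m => by
    simpa [hG l] using renewal (G := G) hU hN {l} l m
  have hs : ∀ (l : Fin n) (m : ℕ), μ.real (noHit (occurrence U G) {l} (m + 1)) =
      μ.real (noHit (occurrence U G) {l} m) -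
        μ.real (firstHit (occurrence U G) {l} l m) := fun l m => by
    rw [measureReal_noHit hU {l} m, Finset.sum_singleton]
    ring
  have h : ∀ m, μ.real (firstHit (occurrence U G) {i} i m) =
        μ.real (firstHit (occurrence U G) {j} j m) ∧
      μ.real (noHit (occurrence U G) {i} m) = μ.real (noHit (occurrence U G) {j} m) := by
    intro m
    induction m with
    | zero => simp [measureReal_firstHit_zero hU hN]
    | succ m ih => rw [← hr, ← hr, hs, hs, ih.1, ih.2]; exact ⟨rfl, rfl⟩
  exact (h k).1

end Renewal

/-! ### Hitting times and the ranking graph -/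

section Times

variable {Ω : Type*} {n N : ℕ} {G : Digraph (Fin n)} {U : ℕ → Fin (n + 1) → Ω → ℕ}

/-- The first time at which the pattern generated by `G` at `l` occurs. -/
noncomputable def generatedTime (U : ℕ → Fin (n + 1) → Ω → ℕ) (G : Digraph (Fin n))
    (l : Fin n) : Ω → ℕ∞ :=
  patternTime U (generatedPattern G l)

theorem natCast_le_generatedTime {l : Fin n} {k : ℕ} {ω : Ω} :
    (k : ℕ∞) ≤ generatedTime U G l ω ↔ ∀ t < k, ω ∉ occurrence U G l t :=
  natCast_le_patternTime

theorem generatedTime_eq_natCast {l : Fin n} {k : ℕ} {ω : Ω} :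
    generatedTime U G l ω = k ↔ ω ∈ firstHit (occurrence U G) {l} l k := by
  have h : generatedTime U G l ω = k ↔ (k : ℕ∞) ≤ generatedTime U G l ω ∧
      ¬ ((k + 1 : ℕ) : ℕ∞) ≤ generatedTime U G l ω := by
    cases generatedTime U G l ω with
    | top => simp
    | coe a => norm_cast; omega
  rw [h, natCast_le_generatedTime, natCast_le_generatedTime]
  simp only [firstHit, noHit, Finset.mem_singleton, Set.mem_inter_iff, Set.mem_ofPred_eq,
    forall_eq, Order.lt_add_one_iff, not_forall, not_not]
  constructor
  · rintro ⟨h1, t, ht, h2⟩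
    rcases ht.lt_or_eq with ht | rfl
    · exact absurd h2 (h1 t ht)
    · exact ⟨h2, h1⟩
  · rintro ⟨h1, h2⟩
    exact ⟨h2, k, le_rfl, h1⟩

theorem generatedTime_eq_top {l : Fin n} {ω : Ω} :
    generatedTime U G l ω = ⊤ ↔ ω ∈ ⋂ k, noHit (occurrence U G) {l} k := by
  rw [ENat.eq_top_iff_forall_ge]
  simp [natCast_le_generatedTime, noHit]

theorem mem_firstHit_iff {C : Finset (Fin n)} {i : Fin n} (hi : i ∈ C) {k : ℕ} {ω : Ω} :
    ω ∈ firstHit (occurrence U G) C i k ↔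
      generatedTime U G i ω = k ∧ ∀ j ∈ C, generatedTime U G i ω ≤ generatedTime U G j ω := by
  constructor
  · intro h
    have h1 : generatedTime U G i ω = k := generatedTime_eq_natCast.2
      ⟨h.1, fun t ht c hc => h.2 t ht c (by rwa [Finset.mem_singleton.1 hc])⟩
    refine ⟨h1, fun j hj => ?_⟩
    rw [h1, natCast_le_generatedTime]
    exact fun t ht => h.2 t ht j hj
  · rintro ⟨h1, h2⟩
    refine ⟨(generatedTime_eq_natCast.1 h1).1, fun t ht c hc => ?_⟩
    have h3 := h2 c hc
    rw [h1, natCast_le_generatedTime] at h3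
    exact h3 t ht

variable [MeasurableSpace Ω] {μ : Measure Ω}

theorem firstProb_nonneg {ι α : Type*} [LinearOrder α] (S : ι → Ω → α) (C : Finset ι) (i : ι) :
    0 ≤ firstProb μ S C i :=
  measureReal_nonneg

theorem measurable_generatedTime (hU : IsUniformArray μ N U) (l : Fin n) :
    Measurable (generatedTime U G l) := by
  refine measurable_to_countable' fun a => ?_
  cases a with
  | top =>
    rw [show generatedTime U G l ⁻¹' {⊤} = ⋂ k, noHit (occurrence U G) {l} k from
      Set.ext fun ω => generatedTime_eq_top]
    exact MeasurableSet.iInter fun k =>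
      measurableSet_noHit fun t _ c _ => measurableSet_occurrence hU c t
  | coe k =>
    rw [show generatedTime U G l ⁻¹' {(k : ℕ∞)} = firstHit (occurrence U G) {l} l k from
      Set.ext fun ω => generatedTime_eq_natCast]
    exact measurableSet_firstHit_occurrence hU _ _ _

variable [IsProbabilityMeasure μ]

theorem measure_generatedTime_eq_top (hU : IsUniformArray μ N U) (hN : n + 1 ≤ N) (l : Fin n) :
    μ {ω | generatedTime U G l ω = ⊤} = 0 := by
  simp_rw [generatedTime_eq_top]
  exact measure_iInter_noHit hU hN (Finset.singleton_nonempty l)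

/-- A tie at a finite time is impossible, and a tie at `⊤` is a null event. -/
theorem noTie_generatedTime (hU : IsUniformArray μ N U) (hN : n + 1 ≤ N) (C : Set (Fin n)) :
    NoTie μ (generatedTime U G) C := by
  intro i _ j _ hij
  refine measure_mono_null (fun ω hω => ?_) (measure_generatedTime_eq_top (G := G) hU hN i)
  by_contra h
  obtain ⟨k, hk⟩ := ENat.ne_top_iff_exists.1 h
  have h1 := generatedTime_eq_natCast.1 hk.symm
  have h2 := generatedTime_eq_natCast.1 ((show _ = _ from hω).symm.trans hk.symm)
  exact Set.disjoint_left.1 (disjoint_occurrence hij k) h1.1 h2.1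

theorem identDistrib_generatedTime (hU : IsUniformArray μ N U) (hN : n + 1 ≤ N)
    (hG : ∀ i, ¬ G.Adj i i) (i j : Fin n) :
    IdentDistrib (generatedTime U G i) (generatedTime U G j) μ μ := by
  refine ⟨(measurable_generatedTime hU i).aemeasurable,
    (measurable_generatedTime hU j).aemeasurable, Measure.ext_of_singleton fun a => ?_⟩
  rw [Measure.map_apply (measurable_generatedTime hU i) (measurableSet_singleton a),
    Measure.map_apply (measurable_generatedTime hU j) (measurableSet_singleton a)]
  cases a with
  | top =>
    exact (measure_generatedTime_eq_top hU hN i).trans (measure_generatedTime_eq_top hU hN j).symm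
  | coe k =>
    have h : ∀ l, generatedTime U G l ⁻¹' {(k : ℕ∞)} = firstHit (occurrence U G) {l} l k :=
      fun l => Set.ext fun ω => generatedTime_eq_natCast
    rw [h, h]
    exact (ENNReal.toReal_eq_toReal_iff' (measure_ne_top μ _) (measure_ne_top μ _)).1
      (measureReal_firstHit_singleton_eq hU hN hG i j k)

theorem firstProb_generatedTime (hU : IsUniformArray μ N U) (hN : n + 1 ≤ N)
    {C : Finset (Fin n)} {i : Fin n} (hi : i ∈ C) :
    firstProb μ (generatedTime U G) C i = μ.real (⋃ k, firstHit (occurrence U G) C i k) := by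
  refine measureReal_congr ?_
  have h : ∀ᵐ ω ∂μ, generatedTime U G i ω ≠ ⊤ := by
    rw [ae_iff]
    simpa using measure_generatedTime_eq_top (G := G) hU hN i
  filter_upwards [h] with ω hω
  refine propext (Iff.trans ?_ Set.mem_iUnion.symm)
  simp_rw [mem_firstHit_iff hi]
  obtain ⟨k, hk⟩ := ENat.ne_top_iff_exists.1 hω
  exact ⟨fun h => ⟨k, hk.symm, h⟩, fun ⟨_, _, h⟩ => h⟩

theorem sum_firstProb_generatedTime (hU : IsUniformArray μ N U) (hN : n + 1 ≤ N)
    {C : Finset (Fin n)} (hC : C.Nonempty) :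
    ∑ i ∈ C, firstProb μ (generatedTime U G) C i = 1 := by
  rw [Finset.sum_congr rfl fun i hi => firstProb_generatedTime hU hN hi,
    sum_measureReal_iUnion_firstHit hU hN hC]

open Classical in
theorem exists_firstProb_balance (hU : IsUniformArray μ N U) (hN : n + 1 ≤ N)
    (C : Finset (Fin n)) :
    ∃ K : ℝ, ∀ j ∈ C, firstProb μ (generatedTime U G) C j + ((N : ℝ)⁻¹) ^ (n + 1) *
      ∑ i ∈ C, (if G.Adj j i then firstProb μ (generatedTime U G) C i else 0) = K := by
  obtain ⟨K, hK⟩ := exists_firstHit_balance (G := G) hU hN C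
  refine ⟨K, fun j hj => ?_⟩
  rw [firstProb_generatedTime hU hN hj, Finset.sum_congr rfl fun i hi => by
    rw [firstProb_generatedTime hU hN hi]]
  exact hK j hj

/-- Without the arrow `i → j`, the balance for `{i, j}` gives `p_i = K ≥ p_j`, so `p_j ≤ 1 / 2`. -/
theorem adj_of_rankingGraph_adj (hU : IsUniformArray μ N U) (hN : n + 1 ≤ N)
    (hG : ∀ i, ¬ G.Adj i i) {i j : Fin n} (hij : i ≠ j)
    (h : (rankingGraph μ (generatedTime U G)).Adj i j) : G.Adj i j := by
  classical
  by_contra hadj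
  obtain ⟨K, hK⟩ := exists_firstProb_balance (G := G) hU hN {i, j}
  have hi := hK i (by simp)
  have hj := hK j (by simp)
  have hsum := sum_firstProb_generatedTime (G := G) hU hN (Finset.insert_nonempty i {j})
  rw [Finset.sum_pair hij] at hi hj hsum
  simp only [hG, hadj, if_false, add_zero, mul_zero] at hi hj
  have hlt : 1 / 2 < firstProb μ (generatedTime U G) {i, j} j := by
    refine lt_of_lt_of_le h (measureReal_mono fun ω hω => ?_)
    have hω' : generatedTime U G j ω < generatedTime U G i ω := hω
    simp [hω'.le]
  have hnn : 0 ≤ ((N : ℝ)⁻¹) ^ (n + 1) *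
      if G.Adj j i then firstProb μ (generatedTime U G) {i, j} i else 0 := by
    have := firstProb_nonneg (μ := μ) (generatedTime U G) {i, j} i
    split_ifs <;> positivity
  linarith

end Times

/-! ### Comparing averages from the balance equations -/

section Balance

variable {ι : Type*} [DecidableEq ι]

open Classical in
-- Each `f i` is counted once per arrow into `i` from within `B`, and `i` itself is not a source.
theorem sum_sum_ite_adj_le {G : Digraph ι} (hG : ∀ i, ¬ G.Adj i i) {f : ι → ℝ} (B : Finset ι)
    (hf : ∀ i ∈ B, 0 ≤ f i) :
    ∑ j ∈ B, ∑ i ∈ B, (if G.Adj j i then f i else 0) ≤ ((B.card : ℝ) - 1) * ∑ i ∈ B, f i := by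
  rw [Finset.sum_comm, Finset.mul_sum]
  refine Finset.sum_le_sum fun i hi => ?_
  rw [← Finset.add_sum_erase B _ hi, if_neg (hG i), zero_add]
  refine (Finset.sum_le_card_nsmul (B.erase i) _ (f i) fun j _ => ?_).trans_eq ?_
  · split_ifs
    exacts [le_rfl, hf i hi]
  · rw [Finset.card_erase_of_mem hi, nsmul_eq_mul,
      Nat.cast_sub (Finset.card_pos.2 ⟨i, hi⟩), Nat.cast_one]

open Classical in
theorem average_lt_average_of_balance {G : Digraph ι} (hG : IsOriented G) {f : ι → ℝ} {q K : ℝ}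
    (hq : 0 < q) {A B : Finset ι} (hA : A.Nonempty) (hB : B.Nonempty) (hAB : Disjoint A B)
    (hadj : PointsTo G A B) (hf : ∀ i, 0 ≤ f i) (hsum : ∑ i ∈ A ∪ B, f i = 1)
    (hK : ∀ j ∈ A ∪ B, f j + q * ∑ i ∈ A ∪ B, (if G.Adj j i then f i else 0) = K) :
    (1 / (A.card : ℝ)) * ∑ i ∈ A, f i < (1 / (B.card : ℝ)) * ∑ i ∈ B, f i := by
  set X : Finset ι → ℝ := fun D => ∑ j ∈ D, ∑ i ∈ D, if G.Adj j i then f i else 0 with hX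
  have hXnn : ∀ D, 0 ≤ X D := fun D => Finset.sum_nonneg fun j _ => Finset.sum_nonneg fun i _ => by
    split_ifs
    exacts [hf i, le_rfl]
  have hXB : X B ≤ ((B.card : ℝ) - 1) * ∑ i ∈ B, f i :=
    sum_sum_ite_adj_le (fun i hi => hG i i hi hi) B fun i _ => hf i
  have ha : (0 : ℝ) < A.card := by exact_mod_cast hA.card_pos
  have hb : (0 : ℝ) < B.card := by exact_mod_cast hB.card_pos
  have hFA : 0 ≤ ∑ i ∈ A, f i := Finset.sum_nonneg fun i _ => hf i
  have hFB : 0 ≤ ∑ i ∈ B, f i := Finset.sum_nonneg fun i _ => hf i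
  have hsplit : ∀ j, ∑ i ∈ A ∪ B, (if G.Adj j i then f i else 0) =
      ∑ i ∈ A, (if G.Adj j i then f i else 0) + ∑ i ∈ B, (if G.Adj j i then f i else 0) :=
    fun j => Finset.sum_union hAB
  have hKB : ∑ i ∈ B, f i + q * X B = B.card * K := by
    rw [hX, Finset.mul_sum, ← Finset.sum_add_distrib, ← nsmul_eq_mul, ← Finset.sum_const]
    refine Finset.sum_congr rfl fun j hj => ?_
    -- An arrow from `B` back to `A` would close a 2-cycle.
    rw [← hK j (Finset.mem_union_right _ hj), hsplit,
      Finset.sum_eq_zero fun i hi => if_neg (hG i j (hadj i hi j hj)), zero_add]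
  have hKA : ∑ i ∈ A, f i + q * (X A + A.card * ∑ i ∈ B, f i) = A.card * K := by
    rw [hX, ← nsmul_eq_mul, ← Finset.sum_const, ← Finset.sum_add_distrib, Finset.mul_sum,
      ← Finset.sum_add_distrib, ← nsmul_eq_mul, ← Finset.sum_const]
    refine Finset.sum_congr rfl fun j hj => ?_
    rw [← hK j (Finset.mem_union_left _ hj), hsplit,
      Finset.sum_congr (s₁ := B) rfl fun i hi => if_pos (hadj j hj i hi)]
  rw [Finset.sum_union hAB] at hsum
  generalize ∑ i ∈ A, f i = a at *
  generalize ∑ i ∈ B, f i = b at *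
  -- If `b = 0`, the equation for `B` forces `K = 0` and then the one for `A` forces `a = 0`,
  -- against `a + b = 1`.
  have hbpos : 0 < b := by
    refine hFB.lt_of_ne fun h => ?_
    have hXB0 : X B = 0 := le_antisymm (by simpa [← h] using hXB) (hXnn B)
    have hK0 : K = 0 := by
      simpa [← h, hXB0, hb.ne'] using hKB.symm
    simp only [hK0, ← h, mul_zero, add_zero] at hKA
    have := mul_nonneg hq.le (hXnn A)
    linarith
  rw [one_div_mul_eq_div, one_div_mul_eq_div, div_lt_div_iff₀ ha hb]
  have key : b * A.card - a * B.card =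
      q * (B.card * X A + A.card * (B.card * b - X B)) := by
    linear_combination (A.card : ℝ) * hKB - (B.card : ℝ) * hKA
  -- The bound `hXB` leaves at least one copy of `b`, the source of strictness.
  have h1 : 0 < (B.card : ℝ) * b - X B := by linarith
  have h2 : 0 < q * (B.card * X A + A.card * (B.card * b - X B)) := by
    have := hXnn A
    positivity
  linarith

end Balance

/-! ### Two-determinacy -/

section Main

variable {Ω : Type*} [MeasurableSpace Ω] {μ : Measure Ω} [IsProbabilityMeasure μ] {n N : ℕ}
  {G : Digraph (Fin n)} {U : ℕ → Fin (n + 1) → Ω → ℕ}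

theorem isTwoDetermined_generatedTime (hU : IsUniformArray μ N U) (hN : n + 1 ≤ N)
    (hG : IsOriented G) : IsTwoDetermined μ (generatedTime U G) := by
  classical
  intro A B hA hB hAB hadj
  have hadj' : PointsTo G A B := fun i hi j hj =>
    adj_of_rankingGraph_adj hU hN (fun l hl => hG l l hl hl)
      (fun h => Finset.disjoint_left.1 hAB hi (h ▸ hj)) (hadj i hi j hj)
  refine ⟨noTie_generatedTime hU hN _, ?_⟩
  obtain ⟨K, hK⟩ := exists_firstProb_balance (G := G) hU hN (A ∪ B)
  have hq : (0 : ℝ) < ((N : ℝ)⁻¹) ^ (n + 1) := by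
    have : (0 : ℝ) < N := by exact_mod_cast (by omega : 0 < N)
    positivity
  rw [Finset.union_comm B A]
  exact average_lt_average_of_balance hG hq hA hB hAB hadj' (fun i => firstProb_nonneg _ _ i)
    (sum_firstProb_generatedTime hU hN (hA.mono Finset.subset_union_left)) hK

end Main

end PatternRank

theorem theorem4p5 {Ω : Type*} [MeasurableSpace Ω] (μ : Measure Ω) [IsProbabilityMeasure μ]
    (n N : ℕ) (hn : 2 ≤ n) (hN : n + 1 ≤ N)
    (G : Digraph (Fin n)) (hG : PatternRank.IsOriented G)
    (U : ℕ → Fin (n + 1) → Ω → ℕ) (hU : PatternRank.IsUniformArray μ N U)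
    (T : Fin n → Ω → ℕ∞)
    (hT : ∀ i, T i = PatternRank.patternTime U (PatternRank.generatedPattern G i)) :
    (∀ i j, IdentDistrib (T i) (T j) μ μ) ∧
      PatternRank.NoTie μ T Set.univ ∧
      PatternRank.IsTwoDetermined μ T := by
  obtain rfl : T = PatternRank.generatedTime U G := funext hT
  exact ⟨PatternRank.identDistrib_generatedTime hU hN fun i hi => hG i i hi hi,
    PatternRank.noTie_generatedTime hU hN _, PatternRank.isTwoDetermined_generatedTime hU hN hG⟩
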